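/- For $g\in L^2(\mathbb{R})$ (complex-valued) and $\lambda=(x,\omega)\in\mathbb{R}^2$ put $\pi(\lambda)g(t)=e^{2\pi i\omega t}g(t-x)$ and $V_gf(\lambda)=\langle f,\pi(\lambda)g\rangle=\int_{\mathbb{R}}f(t)\overline{g(t-x)}e^{-2\pi i\omega t}\,dt$. Feichtinger's algebra $S_0(\mathbb{R})$ consists of all $g\in L^2(\mathbb{R})$ with $V_gg\in L^1(\mathbb{R}^2)$. For a lattice $\Lambda\subset\mathbb{R}^2$, the Gabor system $\mathcal{G}(g,\Lambda)=\{\pi(\lambda)g\mid\lambda\in\Lambda\}$ is a frame if there are constants $0<A\le B<\infty$ with $$A\|f\|^2\le\sum_{\lambda\in\Lambda}|\langle f,\pi(\lambda)g\rangle|^2\le B\|f\|^2\qquad\text{for all } f\in L^2(\mathbb{R}),$$ and its (sharp) lower frame bound is the supremum of all $A\ge 0$ for which the left inequality holds for all $f\in L^2(\mathbb{R})$. **Proposition 5.3.** Let $g\in S_0(\mathbb{R})$ be odd, i.e. $g(-t)=-g(t)$ for almost every $t$. Then, for every $S\in SL(2,\mathbb{R})$, with $\Lambda=S\mathbb{Z}^2$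 (a lattice of density $1$), the lower frame bound of $\mathcal{G}(g,\Lambda)$ is $0$ and $\mathcal{G}(g,\Lambda)$ is not a frame. Moreover, the system $\mathcal{G}\left(g,\mathbb{Z}\times\tfrac12\mathbb{Z}\right)$ (density $2$) is not a frame. -/

import Mathlib

open MeasureTheory
open scoped ENNReal

/-- The Hilbert space `L²(ℝ)` of complex-valued functions. -/
abbrev L2R : Type := Lp ℂ 2 (volume : Measure ℝ)

/-- The time-frequency shift `π(x, ω) g (t) = e^{2πiωt} g(t - x)` on functions. -/
noncomputable def tfShiftFun (p : ℝ × ℝ) (g : ℝ → ℂ) : ℝ → ℂ :=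
  fun t => Complex.exp (2 * Real.pi * Complex.I * p.2 * t) * g (t - p.1)

theorem memLp_tfShiftFun (p : ℝ × ℝ) {g : ℝ → ℂ} (hg : MemLp g 2 volume) :
    MemLp (tfShiftFun p g) 2 volume := by
  have h1 : MemLp (fun t => g (t - p.1)) 2 volume :=
    hg.comp_measurePreserving (measurePreserving_sub_right volume p.1)
  have hc : Continuous fun t : ℝ => Complex.exp (2 * Real.pi * Complex.I * p.2 * t) := by
    fun_prop
  refine h1.of_le (hc.aestronglyMeasurable.mul h1.1) (Filter.Eventually.of_forall fun t => ?_)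
  have h2 : (2 * Real.pi * Complex.I * p.2 * t : ℂ)
      = ((2 * Real.pi * p.2 * t : ℝ) : ℂ) * Complex.I := by
    push_cast
    ring
  simp only [tfShiftFun, norm_mul, h2, Complex.norm_exp_ofReal_mul_I, one_mul, le_refl]

/-- The time-frequency shift `π(x, ω)` acting on `L²(ℝ)`. -/
noncomputable def tfShift (p : ℝ × ℝ) (g : L2R) : L2R :=
  (memLp_tfShiftFun p (Lp.memLp g)).toLp (tfShiftFun p g)

/-- The short-time Fourier transform
`V_g f (x, ω) = ∫ f(t) conj(g(t - x)) e^{-2πiωt} dt`. -/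
noncomputable def stft (g f : L2R) (p : ℝ × ℝ) : ℂ :=
  ∫ t : ℝ, f t * (starRingEnd ℂ) (g (t - p.1)) *
    Complex.exp (-(2 * Real.pi * Complex.I * p.2 * t))

/-- Membership in Feichtinger's algebra `S₀(ℝ)`: the function `V_g g` belongs to `L¹(ℝ²)`. -/
def MemFeichtinger (g : L2R) : Prop :=
  Integrable (stft g g) (volume : Measure (ℝ × ℝ))

/-- The Gabor system `G(g, Λ)`, as the family `(π(p) g)` indexed by the points `p ∈ Λ`. -/
noncomputable def gaborSystem (g : L2R) (Λ : Set (ℝ × ℝ)) : Λ → L2R :=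
  fun p => tfShift p g

/-- The sum `∑ |⟨f, φ_i⟩|²`, as an extended nonnegative number. Mathlib's inner product is
conjugate-linear in the first argument. -/
noncomputable def frameSum {ι : Type} (φ : ι → L2R) (f : L2R) : ℝ≥0∞ :=
  ∑' i, ‖inner ℂ (φ i) f‖ₑ ^ 2

/-- The frame inequality holds with some bounds `0 < A ≤ B < ∞`. -/
def IsFrame {ι : Type} (φ : ι → L2R) : Prop :=
  ∃ A B : ℝ, 0 < A ∧ A ≤ B ∧ ∀ f : L2R,
    ENNReal.ofReal A * ‖f‖ₑ ^ 2 ≤ frameSum φ f ∧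
      frameSum φ f ≤ ENNReal.ofReal B * ‖f‖ₑ ^ 2

/-- The sharp lower frame bound: the largest `A ≥ 0` with `A ‖f‖² ≤ ∑ |⟨f, φ_i⟩|²`
for all `f ∈ L²(ℝ)`. -/
noncomputable def lowerFrameBound {ι : Type} (φ : ι → L2R) : ℝ≥0∞ :=
  sSup {A : ℝ≥0∞ | ∀ f : L2R, A * ‖f‖ₑ ^ 2 ≤ frameSum φ f}

/-- The set `M ℤ² ⊆ ℝ²` of integer combinations of the columns of a matrix `M`. -/
def planeLattice (M : Matrix (Fin 2) (Fin 2) ℝ) : Set (ℝ × ℝ) :=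
  {p | ∃ k l : ℤ, p = (M 0 0 * k + M 0 1 * l, M 1 0 * k + M 1 1 * l)}

open Filter Topology ComplexConjugate FourierTransform

/-! At density 1 the shifts along `S ℤ²`, multiplied by suitable phases, form a unitary
representation `ρ` of `ℤ²`, and a sign character `(-1)^{e k}` may be added. A window whose formal
orbit sum vanishes cannot see joint invariant vectors of `ρ`. Such vectors do not lie in `L²`, so
they are replaced by `f_N = ∑ ρ(p) φ` over `p ∈ [0, N)²`, with `φ` the Gaussian.

Put `b(ν) = ⟨φ, ρ(ν)φ⟩` and `a(ν) = ⟨φ, ρ(ν)g⟩`. Then `‖f_N‖² / N²` tends to `∑ b`, and the frame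
sum of `f_N` over `N²` tends to `|∑ a|²`. Oddness of `g` makes `a` odd, so `∑ a = 0`; and `∑ b ≠ 0`
for `e = 0` or `e = 1`. Hence no positive lower bound survives
(`eq_zero_of_forall_mul_enorm_sq_le`).

The analytic input is `a ∈ ℓ¹`, which follows from `g ∈ S₀` by the orthogonality relations and
uniform bounds for Gaussian lattice sums. For `ℤ × ½ℤ` the second coset of `ℤ²` is again symmetric
under a reflection, so the same `f_N` serve for both cosets. -/

/-! ### Averages over large squares of `ℤ²` -/

/-- The square `[0, N)²` of integer points. -/
noncomputable def intSquare (N : ℕ) : Finset (ℤ × ℤ) := Finset.Ico 0 (N : ℤ) ×ˢ Finset.Ico 0 (N : ℤ)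

/-- The number of points of the square `[0, N)²` which stay in it when translated by `ν`. -/
noncomputable def overlapCount (N : ℕ) (ν : ℤ × ℤ) : ℕ := ((intSquare N).filter fun p => p + ν ∈ intSquare N).card

theorem card_intSquare (N : ℕ) : (intSquare N).card = N ^ 2 := by
  simp [intSquare, Finset.card_product, sq]

theorem overlapCount_le (N : ℕ) (ν : ℤ × ℤ) : overlapCount N ν ≤ N ^ 2 :=
  (Finset.card_filter_le _ _).trans (card_intSquare N).le

/-- The square meets its translate in a rectangle with sides `N - |ν.1|` and `N - |ν.2|`. -/
theorem le_overlapCount {N : ℕ} {ν : ℤ × ℤ} (h1 : |ν.1| ≤ N) (h2 : |ν.2| ≤ N) :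
    ((N : ℤ) - |ν.1|) * (N - |ν.2|) ≤ overlapCount N ν := by
  obtain ⟨k, l⟩ := ν
  have h : (Finset.Ico (max 0 (-k)) (min (N : ℤ) (N - k)) ×ˢ
      Finset.Ico (max 0 (-l)) (min (N : ℤ) (N - l))) ⊆
      (intSquare N).filter fun p => p + (k, l) ∈ intSquare N := by
    intro p hp
    simp only [intSquare, Finset.mem_filter, Finset.mem_product, Finset.mem_Ico, Prod.fst_add,
      Prod.snd_add] at hp ⊢
    omega
  have hc := Finset.card_le_card h
  rw [Finset.card_product, Int.card_Ico, Int.card_Ico] at hc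
  have e1 : (min (N : ℤ) (N - k) - max 0 (-k)) = N - |k| := by
    rcases abs_cases k with ⟨h, _⟩ | ⟨h, _⟩ <;> rw [h] <;> omega
  have e2 : (min (N : ℤ) (N - l) - max 0 (-l)) = N - |l| := by
    rcases abs_cases l with ⟨h, _⟩ | ⟨h, _⟩ <;> rw [h] <;> omega
  rw [e1, e2] at hc
  have hc' : (((N - |k| : ℤ).toNat * (N - |l| : ℤ).toNat : ℕ) : ℤ) ≤ overlapCount N (k, l) :=
    Int.ofNat_le.mpr hc
  rwa [Nat.cast_mul, Int.toNat_of_nonneg (by simpa using h1),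
    Int.toNat_of_nonneg (by simpa using h2)] at hc'

theorem tendsto_overlapCount (ν : ℤ × ℤ) :
    Tendsto (fun N : ℕ => (overlapCount N ν : ℝ) / (N : ℝ) ^ 2) atTop (𝓝 1) := by
  have hlin (m : ℤ) : Tendsto (fun N : ℕ => 1 - (m : ℝ) / (N : ℝ)) atTop (𝓝 1) := by
    simpa using (tendsto_const_div_atTop_nhds_zero_nat (m : ℝ)).const_sub 1
  have hlow := (hlin |ν.1|).mul (hlin |ν.2|)
  rw [one_mul] at hlow
  refine tendsto_of_tendsto_of_tendsto_of_le_of_le' hlow tendsto_const_nhds ?_ ?_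
  · filter_upwards [eventually_ge_atTop (max 1 (max ν.1.natAbs ν.2.natAbs))] with N hN
    have hN0 : (0 : ℝ) < N := by
      have : 0 < N := by omega
      exact_mod_cast this
    have h := le_overlapCount (N := N) (ν := ν) (by rw [Int.abs_eq_natAbs]; omega)
      (by rw [Int.abs_eq_natAbs]; omega)
    have h' : ((N : ℝ) - (|ν.1| : ℤ)) * (N - (|ν.2| : ℤ)) ≤ overlapCount N ν := by exact_mod_cast h
    rw [le_div_iff₀ (by positivity)]
    refine le_trans (le_of_eq ?_) h'
    field_simp
  · filter_upwards with N
    refine div_le_one_of_le₀ ?_ (by positivity)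
    exact_mod_cast overlapCount_le N ν

theorem sum_intSquare_sub (b : ℤ × ℤ → ℂ) (N : ℕ) :
    ∑ p ∈ intSquare N, ∑ q ∈ intSquare N, b (q - p) = ∑' ν, (overlapCount N ν : ℂ) * b ν := by
  have h1 (p : ℤ × ℤ) : HasSum (fun ν => if p + ν ∈ intSquare N then b ν else 0)
      (∑ q ∈ intSquare N, b (q - p)) := by
    rw [← (Equiv.addLeft (-p)).hasSum_iff]
    have : ((fun ν => if p + ν ∈ intSquare N then b ν else 0) ∘ (Equiv.addLeft (-p))) =
        fun q => if q ∈ intSquare N then b (q - p) else 0 := by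
      funext q
      simp [sub_eq_neg_add]
    rw [this, ← Finset.sum_congr rfl fun q hq => if_pos hq]
    exact hasSum_sum_of_ne_finset_zero fun q hq => if_neg hq
  rw [← (hasSum_sum fun p (_ : p ∈ intSquare N) => h1 p).tsum_eq]
  congr 1
  funext ν
  rw [← Finset.sum_filter, Finset.sum_const, nsmul_eq_mul, overlapCount]

/-- Averages of a summable function over differences of points of large squares. -/
theorem tendsto_sum_intSquare_sub {b : ℤ × ℤ → ℂ} (hb : Summable b) :
    Tendsto (fun N : ℕ => (∑ p ∈ intSquare N, ∑ q ∈ intSquare N, b (q - p)) / (N : ℂ) ^ 2)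
      atTop (𝓝 (∑' ν, b ν)) := by
  have h (N : ℕ) : (∑ p ∈ intSquare N, ∑ q ∈ intSquare N, b (q - p)) / (N : ℂ) ^ 2 =
      ∑' ν, (((overlapCount N ν : ℝ) / (N : ℝ) ^ 2 : ℝ) : ℂ) * b ν := by
    rw [sum_intSquare_sub, ← tsum_div_const]
    congr 1
    funext ν
    push_cast
    ring
  simp_rw [h]
  refine tendsto_tsum_of_dominated_convergence hb.norm (fun ν => ?_) ?_
  · have := (Complex.continuous_ofReal.tendsto 1).comp (tendsto_overlapCount ν)
    simpa using this.mul_const (b ν)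
  · filter_upwards with N ν
    rw [norm_mul]
    refine mul_le_of_le_one_left (norm_nonneg _) ?_
    rw [Complex.norm_real, Real.norm_of_nonneg (by positivity)]
    refine div_le_one_of_le₀ ?_ (by positivity)
    exact_mod_cast overlapCount_le N ν

/-- The autocorrelation of a function on `ℤ²`. -/
noncomputable def autocorr (a : ℤ × ℤ → ℂ) (ν : ℤ × ℤ) : ℂ := ∑' κ, a (κ + ν) * conj (a κ)

theorem summable_autocorr_kernel {a : ℤ × ℤ → ℂ} (ha : Summable a) :
    Summable fun x : (ℤ × ℤ) × (ℤ × ℤ) => a (x.2 + x.1) * conj (a x.2) := by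
  have hc : Summable fun κ => conj (a κ) := by
    refine Summable.of_norm ?_
    simpa using ha.norm
  have h := summable_mul_of_summable_norm ha.norm hc.norm
  -- This shear turns the kernel into the product `a x.1 * conj (a x.2)`.
  let e : (ℤ × ℤ) × (ℤ × ℤ) ≃ (ℤ × ℤ) × (ℤ × ℤ) :=
    { toFun := fun x => (x.2 + x.1, x.2)
      invFun := fun x => (x.1 - x.2, x.2)
      left_inv := fun x => by simp
      right_inv := fun x => by simp }
  exact (e.summable_iff (f := fun x : (ℤ × ℤ) × (ℤ × ℤ) => a x.1 * conj (a x.2))).mpr h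

theorem summable_autocorr {a : ℤ × ℤ → ℂ} (ha : Summable a) : Summable (autocorr a) :=
  (summable_autocorr_kernel ha).prod

theorem tsum_autocorr {a : ℤ × ℤ → ℂ} (ha : Summable a) (h0 : ∑' κ, a κ = 0) :
    ∑' ν, autocorr a ν = 0 := by
  have hk := summable_autocorr_kernel ha
  unfold autocorr
  rw [← Summable.tsum_comm (f := fun ν κ => a (κ + ν) * conj (a κ)) hk]
  have (κ : ℤ × ℤ) : ∑' ν, a (κ + ν) * conj (a κ) = 0 := by
    rw [tsum_mul_right, show ∑' x, a (κ + x) = 0 from ((Equiv.addLeft κ).tsum_eq a).trans h0,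
      zero_mul]
  simp [this]

/-! ### Growth of norms and frame sums of orbit sums -/

section Hilbert

variable {H : Type*} [NormedAddCommGroup H] [InnerProductSpace ℂ H]

theorem tendsto_norm_sq_sum_intSquare {φ : ℤ × ℤ → H} {b : ℤ × ℤ → ℂ} (hb : Summable b)
    (hφ : ∀ p q, inner ℂ (φ q) (φ p) = b (q - p)) :
    Tendsto (fun N : ℕ => ((‖∑ p ∈ intSquare N, φ p‖ ^ 2 / (N : ℝ) ^ 2 : ℝ) : ℂ)) atTop
      (𝓝 (∑' ν, b ν)) := by
  refine (tendsto_sum_intSquare_sub hb).congr fun N => ?_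
  push_cast
  congr 1
  have := inner_self_eq_norm_sq_to_K (𝕜 := ℂ) (∑ p ∈ intSquare N, φ p)
  refine Eq.trans ?_ this
  rw [inner_sum]
  refine Finset.sum_congr rfl fun p _ => ?_
  rw [sum_inner]
  exact Finset.sum_congr rfl fun q _ => (hφ p q).symm

theorem hasSum_norm_inner_sq_sum_intSquare {φ γ : ℤ × ℤ → H} {a : ℤ × ℤ → ℂ} (ha : Summable a)
    (hφ : ∀ p q, inner ℂ (γ q) (φ p) = a (q - p)) (N : ℕ) :
    HasSum (fun q => ((‖(inner ℂ (γ q) (∑ p ∈ intSquare N, φ p) : ℂ)‖ ^ 2 : ℝ) : ℂ))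
      (∑ p ∈ intSquare N, ∑ p' ∈ intSquare N, autocorr a (p' - p)) := by
  have hs (p p' : ℤ × ℤ) : HasSum (fun q => a (q - p) * conj (a (q - p'))) (autocorr a (p' - p)) := by
    have h1 := ((summable_autocorr_kernel ha).comp_injective
      (i := fun κ => (p' - p, κ)) (fun x y h => by simpa using h)).hasSum
    rw [← (Equiv.subRight p').hasSum_iff] at h1
    have h2 : (fun q => a (q - p) * conj (a (q - p'))) =
        ((fun x : (ℤ × ℤ) × (ℤ × ℤ) => a (x.2 + x.1) * conj (a x.2)) ∘ fun κ => (p' - p, κ)) ∘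
          Equiv.subRight p' := by
      funext q
      simp
    rw [h2]
    exact h1
  have h2 := hasSum_sum fun p (_ : p ∈ intSquare N) =>
    hasSum_sum fun p' (_ : p' ∈ intSquare N) => hs p p'
  refine h2.congr_fun fun q => ?_
  push_cast
  rw [← Complex.mul_conj', inner_sum, map_sum, Finset.sum_mul_sum]
  simp_rw [hφ]

theorem tendsto_tsum_norm_inner_sq_sum_intSquare {φ γ : ℤ × ℤ → H} {a : ℤ × ℤ → ℂ}
    (ha : Summable a) (h0 : ∑' ν, a ν = 0) (hφ : ∀ p q, inner ℂ (γ q) (φ p) = a (q - p)) :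
    Tendsto (fun N : ℕ => (∑' q, ‖(inner ℂ (γ q) (∑ p ∈ intSquare N, φ p) : ℂ)‖ₑ ^ 2) /
      ENNReal.ofReal ((N : ℝ) ^ 2)) atTop (𝓝 0) := by
  have h1 := tendsto_sum_intSquare_sub (summable_autocorr ha)
  rw [tsum_autocorr ha h0] at h1
  have h2 := ENNReal.tendsto_ofReal h1.norm
  rw [norm_zero, ENNReal.ofReal_zero] at h2
  refine h2.congr' ?_
  filter_upwards [eventually_gt_atTop 0] with N hN
  have hN' : (0 : ℝ) < N := by exact_mod_cast hN
  have h3 := hasSum_norm_inner_sq_sum_intSquare ha hφ N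
  have h4 : Summable fun q => ‖(inner ℂ (γ q) (∑ p ∈ intSquare N, φ p) : ℂ)‖ ^ 2 :=
    Complex.summable_ofReal.mp h3.summable
  rw [← h3.tsum_eq, ← Complex.ofReal_tsum, norm_div, norm_pow, Complex.norm_natCast,
    Complex.norm_real, Real.norm_of_nonneg (tsum_nonneg fun _ => by positivity),
    ENNReal.ofReal_div_of_pos (by positivity), ENNReal.ofReal_tsum_of_nonneg (fun _ => by positivity) h4]
  congr 2
  funext q
  rw [ENNReal.ofReal_pow (norm_nonneg _), ofReal_norm]

/-- If `∑ b ≠ 0`, then the norms of the sums `∑ φ p` over squares grow too fast for a positive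
lower frame bound when the corresponding frame sums are `o(N²)`. -/
theorem eq_zero_of_forall_mul_enorm_sq_le {φ : ℤ × ℤ → H} {b : ℤ × ℤ → ℂ} (hb : Summable b)
    (hφ : ∀ p q, inner ℂ (φ q) (φ p) = b (q - p)) (hb0 : ∑' ν, b ν ≠ 0) {X : ℕ → ℝ≥0∞} {A : ℝ≥0∞}
    (hX : Tendsto (fun N : ℕ => X N / ENNReal.ofReal ((N : ℝ) ^ 2)) atTop (𝓝 0))
    (hA : ∀ N, A * ‖∑ p ∈ intSquare N, φ p‖ₑ ^ 2 ≤ X N) : A = 0 := by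
  have h1 := ENNReal.tendsto_ofReal (tendsto_norm_sq_sum_intSquare hb hφ).norm
  -- A nonzero limit is needed because `A = ∞` is not excluded.
  have hpos : ENNReal.ofReal ‖∑' ν, b ν‖ ≠ 0 := by simpa using hb0
  have h2 := ENNReal.Tendsto.const_mul (a := A) h1 (Or.inl hpos)
  have h3 := le_of_tendsto_of_tendsto h2 hX ?_
  · simpa [hb0] using h3
  · filter_upwards [eventually_gt_atTop 0] with N hN
    have hN' : (0 : ℝ) < N := by exact_mod_cast hN
    rw [Complex.norm_real, Real.norm_of_nonneg (by positivity),
      ENNReal.ofReal_div_of_pos (by positivity), ENNReal.ofReal_pow (norm_nonneg _),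
      ofReal_norm, ← mul_div_assoc]
    gcongr
    exact hA N

end Hilbert

/-! ### Gaussian sums over lattices -/

/-- The point `M p` of the lattice `M ℤ²`. -/
def latticePoint (M : Matrix (Fin 2) (Fin 2) ℝ) (p : ℤ × ℤ) : ℝ × ℝ :=
  (M 0 0 * p.1 + M 0 1 * p.2, M 1 0 * p.1 + M 1 1 * p.2)

theorem summable_int_exp_neg_mul_sq {c : ℝ} (hc : 0 < c) :
    Summable fun m : ℤ => Real.exp (-c * (m : ℝ) ^ 2) := by
  have h : Summable fun m : ℕ => Real.exp (-c * (m : ℝ) ^ 2) := by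
    refine Real.summable_exp_nat_mul_of_ge (by linarith) fun i => ?_
    exact_mod_cast Nat.le_self_pow (by norm_num) i
  refine Summable.of_nat_of_neg ?_ ?_ <;> simpa using h

theorem exp_neg_mul_sub_sq_le {c : ℝ} (hc : 0 ≤ c) (k : ℤ) (s : ℝ) :
    Real.exp (-c * (k - s) ^ 2) ≤ Real.exp c * Real.exp (-(c / 2) * ((k - ⌊s⌋ : ℤ) : ℝ) ^ 2) := by
  rw [← Real.exp_add, Real.exp_le_exp]
  have h1 := Int.fract_nonneg s
  have h2 := (Int.fract_lt_one s).le
  have h3 : s = ⌊s⌋ + Int.fract s := (Int.floor_add_fract s).symm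
  set r := Int.fract s
  have h4 : (k : ℝ) - s = ((k - ⌊s⌋ : ℤ) : ℝ) - r := by push_cast; linarith
  rw [h4]
  generalize ((k - ⌊s⌋ : ℤ) : ℝ) = m
  -- Here `(m - r)² = m²/2 + (m - 2r)²/2 - r²` and `r² ≤ 1`.
  have h5 : m ^ 2 / 2 - 1 ≤ (m - r) ^ 2 := by nlinarith [sq_nonneg (m - 2 * r)]
  nlinarith

/-- Gaussian sums over `ℤ²` are bounded uniformly in the centre of the Gaussian. -/
theorem exists_sum_int_gauss_le {c : ℝ} (hc : 0 < c) :
    ∃ C : ℝ, ∀ (s t : ℝ) (F : Finset (ℤ × ℤ)),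
      ∑ p ∈ F, Real.exp (-c * ((p.1 - s) ^ 2 + (p.2 - t) ^ 2)) ≤ C := by
  have h1 := summable_int_exp_neg_mul_sq (half_pos hc)
  set E : ℤ → ℝ := fun m => Real.exp (-(c / 2) * (m : ℝ) ^ 2) with hE
  have h2 : Summable fun p : ℤ × ℤ => E p.1 * E p.2 :=
    h1.mul_of_nonneg h1 (fun _ => (Real.exp_pos _).le) (fun _ => (Real.exp_pos _).le)
  refine ⟨Real.exp c * Real.exp c * ∑' p : ℤ × ℤ, E p.1 * E p.2, fun s t F => ?_⟩
  have h3 : ∑ p ∈ F, Real.exp (-c * ((p.1 - s) ^ 2 + (p.2 - t) ^ 2)) ≤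
      ∑ p ∈ F, Real.exp c * Real.exp c * (E (p.1 - ⌊s⌋) * E (p.2 - ⌊t⌋)) := by
    refine Finset.sum_le_sum fun p _ => ?_
    rw [mul_add, Real.exp_add]
    refine (mul_le_mul (exp_neg_mul_sub_sq_le hc.le p.1 s) (exp_neg_mul_sub_sq_le hc.le p.2 t)
      (Real.exp_pos _).le (by positivity)).trans (le_of_eq ?_)
    simp only [hE]
    ring
  refine h3.trans ?_
  rw [← Finset.mul_sum]
  refine mul_le_mul_of_nonneg_left ?_ (by positivity)
  rw [← (Equiv.subRight ((⌊s⌋, ⌊t⌋) : ℤ × ℤ)).tsum_eq fun p : ℤ × ℤ => E p.1 * E p.2]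
  exact (h2.comp_injective (Equiv.subRight ((⌊s⌋, ⌊t⌋) : ℤ × ℤ)).injective).sum_le_tsum F
    fun p _ => by positivity

/-- Gaussian sums over a lattice are bounded uniformly in the centre of the Gaussian. -/
theorem exists_sum_lattice_gauss_le (S : Matrix.SpecialLinearGroup (Fin 2) ℝ) :
    ∃ C : ℝ, ∀ (y : ℝ × ℝ) (F : Finset (ℤ × ℤ)),
      ∑ p ∈ F, Real.exp (-(Real.pi / 2) * ((y.1 - (latticePoint S.1 p).1) ^ 2 +
        (y.2 - (latticePoint S.1 p).2) ^ 2)) ≤ C := by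
  obtain ⟨S, hS⟩ := S
  rw [Matrix.det_fin_two] at hS
  simp only [latticePoint]
  generalize S 0 0 = a at *
  generalize S 0 1 = b at *
  generalize S 1 0 = c at *
  generalize S 1 1 = d at *
  -- `Q` is the squared Hilbert–Schmidt norm of `S`, and of `S⁻¹` since the determinant is 1. So
  -- `|S⁻¹Y|² ≤ Q |Y|²`, and the sum is compared with one over `ℤ²` centred at `S⁻¹y`.
  set Q := a ^ 2 + b ^ 2 + c ^ 2 + d ^ 2 with hQ
  have hQ0 : 0 < Q := by nlinarith [sq_nonneg (a - d), sq_nonneg (b + c)]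
  obtain ⟨C, hC⟩ := exists_sum_int_gauss_le (c := Real.pi / 2 / Q) (by positivity)
  refine ⟨C, fun y F => le_trans (Finset.sum_le_sum fun p _ => ?_)
    (hC (d * y.1 - b * y.2) (a * y.2 - c * y.1) F)⟩
  rw [Real.exp_le_exp, neg_mul, neg_mul, neg_le_neg_iff, div_mul_eq_mul_div,
    div_le_iff₀ hQ0, mul_assoc]
  refine mul_le_mul_of_nonneg_left ?_ (by positivity)
  set Y1 := y.1 - (a * p.1 + b * p.2) with hY1
  set Y2 := y.2 - (c * p.1 + d * p.2) with hY2
  have e1 : (p.1 : ℝ) - (d * y.1 - b * y.2) = b * Y2 - d * Y1 := by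
    rw [hY1, hY2]
    linear_combination (-(p.1 : ℝ)) * hS
  have e2 : (p.2 : ℝ) - (a * y.2 - c * y.1) = c * Y1 - a * Y2 := by
    rw [hY1, hY2]
    linear_combination (-(p.2 : ℝ)) * hS
  rw [e1, e2, hQ]
  nlinarith [sq_nonneg (b * Y1 + d * Y2), sq_nonneg (c * Y2 + a * Y1)]

/-! ### Fourier uniqueness for integrable functions -/

theorem Real.integral_fourier_mul_eq {f h : ℝ → ℂ} (hf : Integrable f) (hh : Integrable h) :
    ∫ ξ, FourierTransform.fourier f ξ * h ξ = ∫ x, f x * FourierTransform.fourier h x := by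
  simpa using! VectorFourier.integral_fourierIntegral_smul_eq_flip (L := innerₗ ℝ)
    Real.continuous_fourierChar continuous_inner hf hh

/-- Every test function is the Fourier transform of a Schwartz function, so the multiplication
formula moves the transform onto `f`. -/
theorem Real.ae_eq_zero_of_fourier_eq_zero {f : ℝ → ℂ} (hf : Integrable f)
    (h0 : ∀ ξ, FourierTransform.fourier f ξ = 0) : f =ᵐ[volume] 0 := by
  refine ae_eq_zero_of_integral_contDiff_smul_eq_zero hf.locallyIntegrable fun h hh hc => ?_
  have hc' : HasCompactSupport fun x => (h x : ℂ) := hc.comp_left (g := fun x : ℝ => (x : ℂ)) rfl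
  have hh' : ContDiff ℝ (⊤ : ℕ∞) fun x => (h x : ℂ) := Complex.ofRealCLM.contDiff.comp hh
  let s : SchwartzMap ℝ ℂ := hc'.toSchwartzMap hh'
  let r : SchwartzMap ℝ ℂ := FourierTransformInv.fourierInv s
  have hr : FourierTransform.fourier (r : ℝ → ℂ) = fun x => (h x : ℂ) := by
    rw [← SchwartzMap.fourier_coe, FourierTransform.fourier_fourierInv_eq]
    rfl
  have := Real.integral_fourier_mul_eq r.integrable hf
  rw [hr] at this
  simpa [h0] using this

/-! ### Time-frequency shifts on `L²` -/

theorem inner_L2R (f g : L2R) : (inner ℂ f g : ℂ) = ∫ t, g t * conj (f t) := by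
  rw [L2.inner_def]
  simp only [RCLike.inner_apply]

theorem coeFn_tfShift (p : ℝ × ℝ) (g : L2R) : tfShift p g =ᵐ[volume] tfShiftFun p g :=
  MemLp.coeFn_toLp _

theorem tfShiftFun_congr_ae (p : ℝ × ℝ) {f g : ℝ → ℂ} (h : f =ᵐ[volume] g) :
    tfShiftFun p f =ᵐ[volume] tfShiftFun p g := by
  have := (measurePreserving_sub_right volume p.1).quasiMeasurePreserving.ae_eq_comp h
  filter_upwards [this] with t ht
  simp only [Function.comp_apply] at ht
  simp only [tfShiftFun, ht]

theorem conj_exp_modulation (ω t : ℝ) :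
    conj (Complex.exp (2 * Real.pi * Complex.I * ω * t)) =
      Complex.exp (-(2 * Real.pi * Complex.I * ω * t)) := by
  rw [← Complex.exp_conj]
  congr 1
  simp [map_ofNat]

theorem tfShift_tfShift (p q : ℝ × ℝ) (g : L2R) :
    tfShift p (tfShift q g) =
      Complex.exp (-(2 * Real.pi * Complex.I * p.1 * q.2)) • tfShift (p + q) g := by
  refine Lp.ext ?_
  filter_upwards [coeFn_tfShift p (tfShift q g), tfShiftFun_congr_ae p (coeFn_tfShift q g),
    coeFn_tfShift (p + q) g,
    Lp.coeFn_smul (Complex.exp (-(2 * Real.pi * Complex.I * p.1 * q.2))) (tfShift (p + q) g)]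
    with t h1 h2 h3 h4
  rw [h1, h2, h4, Pi.smul_apply, h3]
  simp only [tfShiftFun, smul_eq_mul, Prod.fst_add, Prod.snd_add, ← mul_assoc, ← Complex.exp_add]
  rw [sub_sub]
  congr 2
  push_cast
  ring

theorem inner_tfShift_tfShift_self (p : ℝ × ℝ) (f g : L2R) :
    (inner ℂ (tfShift p f) (tfShift p g) : ℂ) = inner ℂ f g := by
  rw [inner_L2R, inner_L2R, ← integral_sub_right_eq_self (fun t => g t * conj (f t)) p.1]
  refine integral_congr_ae ?_
  filter_upwards [coeFn_tfShift p f, coeFn_tfShift p g] with t h1 h2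
  rw [h1, h2, tfShiftFun, tfShiftFun, map_mul, conj_exp_modulation]
  rw [mul_mul_mul_comm, ← Complex.exp_add, add_neg_cancel, Complex.exp_zero, one_mul]

/-! ### The Gaussian and its short-time Fourier transform -/

/-- The Gaussian `e^{-πt²}`. -/
noncomputable def gaussFun (t : ℝ) : ℂ := Complex.exp (-Real.pi * (t : ℂ) ^ 2)

theorem continuous_gaussFun : Continuous gaussFun := by
  unfold gaussFun
  fun_prop

theorem memLp_gaussFun : MemLp gaussFun 2 volume := by
  refine (memLp_two_iff_integrable_sq_norm continuous_gaussFun.aestronglyMeasurable).mpr ?_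
  refine (integrable_exp_neg_mul_sq (b := 2 * Real.pi) (by positivity)).congr ?_
  filter_upwards with t
  have h : (-Real.pi * (t : ℂ) ^ 2) = ((-Real.pi * t ^ 2 : ℝ) : ℂ) := by push_cast; ring
  rw [gaussFun, h, Complex.norm_exp_ofReal, ← Real.exp_nat_mul]
  congr 1
  push_cast
  ring

/-- The Gaussian `e^{-πt²}` as an element of `L²(ℝ)`. -/
noncomputable def gauss : L2R := memLp_gaussFun.toLp gaussFun

theorem coeFn_gauss : gauss =ᵐ[volume] gaussFun := MemLp.coeFn_toLp _

theorem coeFn_tfShift_gauss (p : ℝ × ℝ) : tfShift p gauss =ᵐ[volume] tfShiftFun p gaussFun :=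
  (coeFn_tfShift p gauss).trans (tfShiftFun_congr_ae p coeFn_gauss)

theorem tfShiftFun_gaussFun (p : ℝ × ℝ) (t : ℝ) :
    tfShiftFun p gaussFun t = Complex.exp (-Real.pi * (t : ℂ) ^ 2 +
      (2 * Real.pi * (p.1 + Complex.I * p.2)) * t - Real.pi * p.1 ^ 2) := by
  rw [tfShiftFun, gaussFun, ← Complex.exp_add]
  congr 1
  push_cast
  ring

theorem conj_tfShiftFun_gaussFun (p : ℝ × ℝ) (t : ℝ) :
    conj (tfShiftFun p gaussFun t) = Complex.exp (-Real.pi * (t : ℂ) ^ 2 +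
      (2 * Real.pi * (p.1 - Complex.I * p.2)) * t - Real.pi * p.1 ^ 2) := by
  rw [tfShiftFun_gaussFun, ← Complex.exp_conj]
  congr 1
  simp only [map_add, map_sub, map_mul, map_neg, map_pow, map_ofNat, Complex.conj_ofReal,
    Complex.conj_I]
  ring

/-- The constant `∫ e^{-2πt²} dt`. -/
noncomputable def gaussConst : ℂ := ((Real.pi : ℂ) / (2 * Real.pi)) ^ (1 / 2 : ℂ)

theorem gaussConst_ne_zero : gaussConst ≠ 0 := by
  have : (Real.pi : ℂ) ≠ 0 := by exact_mod_cast Real.pi_ne_zero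
  rw [gaussConst, Complex.cpow_ne_zero_iff]
  left
  simp [this]

theorem integral_cexp_two_pi_quadratic (c d : ℂ) :
    ∫ t : ℝ, Complex.exp (-(2 * Real.pi) * (t : ℂ) ^ 2 + c * t + d) =
      gaussConst * Complex.exp (d + c ^ 2 / (8 * Real.pi)) := by
  have hre : (-(2 * Real.pi) : ℂ).re < 0 := by simp [Real.pi_pos]
  rw [integral_cexp_quadratic hre, neg_neg, gaussConst]
  congr 2
  have : (Real.pi : ℂ) ≠ 0 := by exact_mod_cast Real.pi_ne_zero
  field_simp
  ring

theorem inner_tfShift_gauss (p : ℝ × ℝ) :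
    (inner ℂ (tfShift p gauss) gauss : ℂ) = Complex.exp (-(Real.pi * Complex.I * p.1 * p.2)) *
      (gaussConst * (Real.exp (-(Real.pi / 2) * (p.1 ^ 2 + p.2 ^ 2)) : ℝ)) := by
  have h : (inner ℂ (tfShift p gauss) gauss : ℂ) = ∫ t : ℝ, Complex.exp (-(2 * Real.pi) * (t : ℂ) ^ 2
      + (2 * Real.pi * (p.1 - Complex.I * p.2)) * t + (-Real.pi * p.1 ^ 2)) := by
    rw [inner_L2R]
    refine integral_congr_ae ?_
    filter_upwards [coeFn_gauss, coeFn_tfShift_gauss p] with t h1 h2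
    rw [h1, h2, conj_tfShiftFun_gaussFun, gaussFun, ← Complex.exp_add]
    congr 1
    ring
  rw [h, integral_cexp_two_pi_quadratic, Complex.ofReal_exp, mul_left_comm, ← Complex.exp_add]
  congr 2
  have : (Real.pi : ℂ) ≠ 0 := by exact_mod_cast Real.pi_ne_zero
  push_cast
  field_simp
  ring_nf
  simp only [Complex.I_sq]
  ring

/-- Pure modulations suffice: their coefficients are the Fourier transform of `g` times the
Gaussian, and the Gaussian has no zeros. -/
theorem exists_inner_tfShift_gauss_ne_zero {g : L2R} (hg : g ≠ 0) :
    ∃ w : ℝ × ℝ, (inner ℂ (tfShift w gauss) g : ℂ) ≠ 0 := by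
  by_contra! h
  apply hg
  have hint : Integrable fun t => g t * gaussFun t :=
    (Lp.memLp g).integrable_mul memLp_gaussFun
  have h0 := Real.ae_eq_zero_of_fourier_eq_zero hint fun ω => by
    rw [← h (0, ω), Real.fourier_real_eq_integral_exp_smul, inner_L2R]
    refine integral_congr_ae ?_
    filter_upwards [coeFn_tfShift_gauss (0, ω)] with t ht
    rw [ht, conj_tfShiftFun_gaussFun, gaussFun, smul_eq_mul, mul_left_comm, ← Complex.exp_add]
    congr 2
    push_cast
    ring
  refine Lp.ext ?_
  filter_upwards [h0, Lp.coeFn_zero ℂ 2 (volume : Measure ℝ)] with t h1 h2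
  rw [h2]
  simpa [gaussFun, Complex.exp_ne_zero] using h1

/-! ### Orthogonality relations and sampling in `S₀` -/

/-- The short-time Fourier transform of `π(q)φ` with window `π(w)φ` for the Gaussian `φ`, up to
conjugation. -/
noncomputable def gaussKernel (w q p : ℝ × ℝ) : ℂ :=
  gaussConst * Complex.exp (-Real.pi * p.1 ^ 2 - (2 * Real.pi * (w.1 + Complex.I * w.2)) * p.1
    - Real.pi * w.1 ^ 2 - Real.pi * q.1 ^ 2 +
    ((2 * Real.pi * (w.1 + Complex.I * w.2 + q.1 - Complex.I * q.2 + p.1)) +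
      2 * Real.pi * Complex.I * p.2) ^ 2 / (8 * Real.pi))

theorem continuous_gaussKernel (w q : ℝ × ℝ) : Continuous (gaussKernel w q) := by
  unfold gaussKernel
  fun_prop

theorem norm_gaussKernel (w q p : ℝ × ℝ) :
    ‖gaussKernel w q p‖ = ‖gaussConst‖ * Real.exp (-(Real.pi / 2) *
      (((p.1 + w.1) - q.1) ^ 2 + ((p.2 + w.2) - q.2) ^ 2)) := by
  rw [gaussKernel, norm_mul, Complex.norm_exp]
  congr 2
  have h : (8 * Real.pi : ℂ) = ((8 * Real.pi : ℝ) : ℂ) := by push_cast; ring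
  rw [Complex.add_re, h, Complex.div_ofReal_re]
  simp [sq]
  field_simp
  ring

theorem gaussKernel_eq_fourierInv (w q : ℝ × ℝ) (x ω : ℝ) :
    gaussKernel w q (x, ω) = 𝓕⁻ (fun s : ℝ => tfShiftFun w gaussFun (s - x) *
      conj (tfShiftFun q gaussFun s)) ω := by
  rw [Real.fourierInv_eq', gaussKernel]
  dsimp only
  rw [← integral_cexp_two_pi_quadratic]
  congr 1
  funext s
  rw [conj_tfShiftFun_gaussFun, tfShiftFun_gaussFun, smul_eq_mul, ← Complex.exp_add,
    ← Complex.exp_add]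
  congr 1
  simp
  ring

theorem integrable_gaussKernel_snd (w q : ℝ × ℝ) (x : ℝ) :
    Integrable fun ω : ℝ => gaussKernel w q (x, ω) := by
  have hc : Continuous fun ω : ℝ => gaussKernel w q (x, ω) :=
    (continuous_gaussKernel w q).comp (by fun_prop)
  have h : Integrable fun ω : ℝ => ‖gaussConst‖ * (Real.exp (-(Real.pi / 2) *
      ((x + w.1) - q.1) ^ 2) * Real.exp (-(Real.pi / 2) * (ω - (q.2 - w.2)) ^ 2)) :=
    (((integrable_exp_neg_mul_sq (b := Real.pi / 2) (by positivity)).comp_sub_right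
      (q.2 - w.2)).const_mul _).const_mul _
  refine h.mono' hc.aestronglyMeasurable (Eventually.of_forall fun ω => le_of_eq ?_)
  rw [norm_gaussKernel, mul_add, Real.exp_add]
  ring_nf

theorem fourier_gaussKernel_snd (w q : ℝ × ℝ) (x t : ℝ) :
    𝓕 (fun ω : ℝ => gaussKernel w q (x, ω)) t =
      tfShiftFun w gaussFun (t - x) * conj (tfShiftFun q gaussFun t) := by
  set u : ℝ → ℂ := fun s => tfShiftFun w gaussFun (s - x) * conj (tfShiftFun q gaussFun s) with hu
  have h1 : (fun ω : ℝ => gaussKernel w q (x, ω)) = 𝓕⁻ u :=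
    funext fun ω => gaussKernel_eq_fourierInv w q x ω
  have hcont : Continuous u := by
    simp only [hu, tfShiftFun_gaussFun]
    fun_prop
  have hint : Integrable u := by
    have hre : (-(2 * Real.pi) : ℂ).re < 0 := by simp [Real.pi_pos]
    refine (integrable_cexp_quadratic' hre
      (2 * Real.pi * (w.1 + Complex.I * w.2 + q.1 - Complex.I * q.2 + x))
      (-Real.pi * x ^ 2 - (2 * Real.pi * (w.1 + Complex.I * w.2)) * x
        - Real.pi * w.1 ^ 2 - Real.pi * q.1 ^ 2)).congr (Eventually.of_forall fun s => ?_)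
    simp only [hu]
    rw [conj_tfShiftFun_gaussFun, tfShiftFun_gaussFun, ← Complex.exp_add]
    congr 1
    push_cast
    ring
  have hF : Integrable (𝓕 u) := by
    refine (integrable_gaussKernel_snd w q x).comp_neg.congr (Eventually.of_forall fun ω => ?_)
    dsimp only
    rw [gaussKernel_eq_fourierInv, Real.fourierInv_eq_fourier_neg, neg_neg]
  rw [h1, hcont.fourier_fourierInv_eq hint hF]

theorem integrable_stft_mul_gaussKernel {g : L2R} (hg : MemFeichtinger g) (w q : ℝ × ℝ) :
    Integrable fun p => stft g g p * gaussKernel w q p := by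
  refine Integrable.mul_bdd (c := ‖gaussConst‖) hg
    (continuous_gaussKernel w q).aestronglyMeasurable (Eventually.of_forall fun p => ?_)
  rw [norm_gaussKernel]
  refine mul_le_of_le_one_right (norm_nonneg _) (Real.exp_le_one_iff.mpr ?_)
  rw [neg_mul, neg_nonpos]
  positivity

theorem integrable_mul_conj_translate (g : L2R) (x : ℝ) :
    Integrable fun t => g t * conj (g (t - x)) := by
  have h : MemLp (fun t => conj (g (t - x))) 2 volume :=
    ((Lp.memLp g).comp_measurePreserving (measurePreserving_sub_right volume x)).star
  exact (Lp.memLp g).integrable_mul h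

/-- A case of the orthogonality relations for the short-time Fourier transform. -/
theorem integral_stft_mul_gaussKernel {g : L2R} (hg : MemFeichtinger g) (w q : ℝ × ℝ) :
    ∫ p, stft g g p * gaussKernel w q p =
      inner ℂ (tfShift q gauss) g * inner ℂ g (tfShift w gauss) := by
  have hV (x : ℝ) : (fun ω => stft g g (x, ω)) = 𝓕 (fun t => g t * conj (g (t - x))) := by
    funext ω
    rw [Real.fourier_real_eq_integral_exp_smul, stft]
    congr 1
    funext t
    rw [smul_eq_mul, mul_comm]
    congr 2
    push_cast
    ring
  have h1 (x : ℝ) : ∫ ω, stft g g (x, ω) * gaussKernel w q (x, ω) =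
      ∫ t, (g t * conj (tfShiftFun q gaussFun t)) *
        (tfShiftFun w gaussFun (t - x) * conj (g (t - x))) := by
    have := Real.integral_fourier_mul_eq (integrable_mul_conj_translate g x)
      (integrable_gaussKernel_snd w q x)
    rw [← hV] at this
    rw [this]
    congr 1
    funext t
    rw [fourier_gaussKernel_snd]
    ring
  have hF : Integrable fun t => g t * conj (tfShiftFun q gaussFun t) :=
    (Lp.memLp g).integrable_mul (memLp_tfShiftFun q memLp_gaussFun).star
  have hG : Integrable fun t => tfShiftFun w gaussFun t * conj (g t) :=
    (memLp_tfShiftFun w memLp_gaussFun).integrable_mul (Lp.memLp g).star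
  -- After the `ω`-integration, the function of `x` is the convolution of the first factor with the
  -- reflected second one, so its integral splits into a product.
  have h2 := integral_convolution (ContinuousLinearMap.mul ℂ ℂ) hF hG.comp_neg
    (μ := volume) (ν := volume)
  rw [integral_neg_eq_self (fun t => tfShiftFun w gaussFun t * conj (g t)) volume] at h2
  rw [Measure.volume_eq_prod, integral_prod _ (integrable_stft_mul_gaussKernel hg w q)]
  simp_rw [h1]
  have h3 : (inner ℂ (tfShift q gauss) g : ℂ) = ∫ t, g t * conj (tfShiftFun q gaussFun t) := by
    rw [inner_L2R]
    refine integral_congr_ae ?_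
    filter_upwards [coeFn_tfShift_gauss q] with t ht
    rw [ht]
  have h4 : (inner ℂ g (tfShift w gauss) : ℂ) = ∫ t, tfShiftFun w gaussFun t * conj (g t) := by
    rw [inner_L2R]
    refine integral_congr_ae ?_
    filter_upwards [coeFn_tfShift_gauss w] with t ht
    rw [ht]
  rw [h3, h4]
  simpa [convolution] using h2

theorem norm_inner_tfShift_gauss_mul_le {g : L2R} (hg : MemFeichtinger g) (w q : ℝ × ℝ) :
    ‖(inner ℂ (tfShift q gauss) g : ℂ)‖ * ‖(inner ℂ g (tfShift w gauss) : ℂ)‖ ≤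
      ∫ p, ‖stft g g p‖ * (‖gaussConst‖ * Real.exp (-(Real.pi / 2) *
        (((p.1 + w.1) - q.1) ^ 2 + ((p.2 + w.2) - q.2) ^ 2))) := by
  rw [← norm_mul, ← integral_stft_mul_gaussKernel hg]
  refine (norm_integral_le_integral_norm _).trans (le_of_eq ?_)
  simp_rw [norm_mul, norm_gaussKernel]

/-- The short-time Fourier transform of an element of Feichtinger's algebra with Gaussian window is
summable over translates of lattices. -/
theorem summable_inner_tfShift_gauss {g : L2R} (hg : MemFeichtinger g)
    (S : Matrix.SpecialLinearGroup (Fin 2) ℝ) (v : ℝ × ℝ) :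
    Summable fun p : ℤ × ℤ => ‖(inner ℂ (tfShift (latticePoint S.1 p + v) gauss) g : ℂ)‖ := by
  by_cases hg0 : g = 0
  · simp [hg0, summable_zero]
  -- Fixing one nonzero coefficient allows division by it. The samples are then dominated by `|V_g
  -- g|` integrated against Gaussians centred at lattice points, whose sum is uniformly bounded.
  obtain ⟨w, hw⟩ := exists_inner_tfShift_gauss_ne_zero hg0
  have hw' : 0 < ‖(inner ℂ g (tfShift w gauss) : ℂ)‖ := by
    rw [norm_inner_symm]
    exact norm_pos_iff.mpr hw
  obtain ⟨C, hC⟩ := exists_sum_lattice_gauss_le S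
  refine summable_of_sum_le (c := (∫ p, ‖stft g g p‖ * (‖gaussConst‖ * C)) /
    ‖(inner ℂ g (tfShift w gauss) : ℂ)‖) (fun _ => norm_nonneg _) fun F => ?_
  rw [le_div_iff₀ hw', Finset.sum_mul]
  refine (Finset.sum_le_sum fun p _ => norm_inner_tfShift_gauss_mul_le hg w _).trans ?_
  have hi (q : ℝ × ℝ) : Integrable fun p : ℝ × ℝ => ‖stft g g p‖ * (‖gaussConst‖ * Real.exp
      (-(Real.pi / 2) * (((p.1 + w.1) - q.1) ^ 2 + ((p.2 + w.2) - q.2) ^ 2))) := by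
    simp_rw [← norm_gaussKernel, ← norm_mul]
    exact (integrable_stft_mul_gaussKernel hg w q).norm
  rw [← integral_finsetSum _ fun p _ => hi _]
  refine integral_mono (integrable_finsetSum _ fun p _ => hi _) (hg.norm.mul_const _) fun p => ?_
  dsimp only
  rw [← Finset.mul_sum, ← Finset.mul_sum]
  refine mul_le_mul_of_nonneg_left (mul_le_mul_of_nonneg_left ?_ (norm_nonneg _)) (norm_nonneg _)
  refine le_trans (le_of_eq (Finset.sum_congr rfl fun m _ => ?_))
    (hC (p.1 + w.1 - v.1, p.2 + w.2 - v.2) F)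
  simp only [Prod.fst_add, Prod.snd_add]
  congr 2
  ring

theorem tfShift_zero (g : L2R) : tfShift 0 g = g := by
  refine Lp.ext ?_
  filter_upwards [coeFn_tfShift 0 g] with t ht
  rw [ht]
  simp [tfShiftFun]

theorem norm_exp_mul_I_ofReal {z : ℂ} (x : ℝ) (hz : z = Complex.I * x) : ‖Complex.exp z‖ = 1 := by
  rw [hz, mul_comm, Complex.norm_exp_ofReal_mul_I]

theorem conj_exp_I_mul_ofReal (x : ℝ) :
    conj (Complex.exp (Complex.I * x)) = Complex.exp (-(Complex.I * x)) := by
  rw [← Complex.exp_conj]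
  simp

/-- Exchanges window and function, to pass from Gaussian window to window `g`. -/
theorem norm_inner_tfShift (q : ℝ × ℝ) (f g : L2R) :
    ‖(inner ℂ (tfShift q g) f : ℂ)‖ = ‖(inner ℂ (tfShift (-q) f) g : ℂ)‖ := by
  rw [← inner_tfShift_tfShift_self (-q), tfShift_tfShift, neg_add_cancel, tfShift_zero,
    inner_smul_left, norm_mul, RCLike.norm_conj,
    norm_exp_mul_I_ofReal (2 * Real.pi * q.1 * q.2) (by simp; ring), one_mul, norm_inner_symm]

theorem latticePoint_neg (M : Matrix (Fin 2) (Fin 2) ℝ) (p : ℤ × ℤ) :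
    latticePoint M (-p) = -latticePoint M p := by
  simp only [latticePoint, Prod.fst_neg, Prod.snd_neg, Prod.neg_mk]
  ext <;> push_cast <;> ring

theorem summable_norm_inner_gauss {g : L2R} (hg : MemFeichtinger g)
    (S : Matrix.SpecialLinearGroup (Fin 2) ℝ) (v : ℝ × ℝ) :
    Summable fun p : ℤ × ℤ => ‖(inner ℂ (tfShift (latticePoint S.1 p + v) g) gauss : ℂ)‖ := by
  rw [← (Equiv.neg (ℤ × ℤ)).summable_iff]
  refine (summable_inner_tfShift_gauss hg S (-v)).congr fun p => ?_
  simp only [Function.comp_apply, Equiv.neg_apply]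
  rw [norm_inner_tfShift, latticePoint_neg, neg_add, neg_neg]

/-! ### The twisted representation of `ℤ²` -/

/-- The argument of the phase that turns the time-frequency shifts along the lattice `S ℤ²` into a
representation of `ℤ²`. -/
noncomputable def latticePhase (e : ℤ) (M : Matrix (Fin 2) (Fin 2) ℝ) (p : ℤ × ℤ) : ℝ :=
  Real.pi * (p.1 * p.2 + e * p.1 - (latticePoint M p).1 * (latticePoint M p).2)

/-- The representation of `ℤ²` by time-frequency shifts along the lattice `S ℤ²`, twisted by the
character `(k, l) ↦ (-1)^{e k}`. -/
noncomputable def latticeShift (e : ℤ) (M : Matrix (Fin 2) (Fin 2) ℝ) (p : ℤ × ℤ) (g : L2R) :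
    L2R :=
  Complex.exp (Complex.I * latticePhase e M p) • tfShift (latticePoint M p) g

theorem inner_latticeShift_left (e : ℤ) (M : Matrix (Fin 2) (Fin 2) ℝ) (p : ℤ × ℤ) (f g : L2R) :
    (inner ℂ (latticeShift e M p g) f : ℂ) =
      Complex.exp (-(Complex.I * latticePhase e M p)) *
        inner ℂ (tfShift (latticePoint M p) g) f := by
  rw [latticeShift, inner_smul_left, conj_exp_I_mul_ofReal]

theorem norm_inner_latticeShift_left (e : ℤ) (M : Matrix (Fin 2) (Fin 2) ℝ) (p : ℤ × ℤ)
    (f g : L2R) : ‖(inner ℂ (latticeShift e M p g) f : ℂ)‖ =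
      ‖(inner ℂ (tfShift (latticePoint M p) g) f : ℂ)‖ := by
  rw [inner_latticeShift_left, norm_mul,
    norm_exp_mul_I_ofReal (-latticePhase e M p) (by push_cast; ring), one_mul]

/-- Since `det S = 1`, the symplectic form is integer-valued on the lattice. The remaining sign
cocycle is the coboundary of `(-1)^{kl}`, which the phase contains. -/
theorem inner_latticeShift_latticeShift (e : ℤ) (S : Matrix.SpecialLinearGroup (Fin 2) ℝ)
    (f g : L2R) (p q : ℤ × ℤ) :
    (inner ℂ (latticeShift e S.1 q g) (latticeShift e S.1 p f) : ℂ) =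
      inner ℂ (latticeShift e S.1 (q - p) g) f := by
  have hsub : latticePoint S.1 p + latticePoint S.1 (q - p) = latticePoint S.1 q := by
    simp only [latticePoint, Prod.fst_sub, Prod.snd_sub, Prod.mk_add_mk]
    ext <;> push_cast <;> ring
  have h1 := tfShift_tfShift (latticePoint S.1 p) (latticePoint S.1 (q - p)) g
  rw [hsub] at h1
  have h2 : tfShift (latticePoint S.1 q) g = Complex.exp (Complex.I * (2 * Real.pi *
      (latticePoint S.1 p).1 * (latticePoint S.1 (q - p)).2 : ℝ)) •
      tfShift (latticePoint S.1 p) (tfShift (latticePoint S.1 (q - p)) g) := by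
    rw [h1, smul_smul, ← Complex.exp_add]
    rw [show Complex.I * (2 * Real.pi * (latticePoint S.1 p).1 *
      (latticePoint S.1 (q - p)).2 : ℝ) + -(2 * Real.pi * Complex.I * (latticePoint S.1 p).1 *
      (latticePoint S.1 (q - p)).2) = 0 by push_cast; ring, Complex.exp_zero, one_smul]
  rw [inner_latticeShift_left, inner_latticeShift_left, latticeShift, inner_smul_right, h2,
    inner_smul_left, conj_exp_I_mul_ofReal, inner_tfShift_tfShift_self, ← mul_assoc, ← mul_assoc,
    ← Complex.exp_add, ← Complex.exp_add]
  congr 1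
  rw [Complex.exp_eq_exp_iff_exists_int]
  refine ⟨p.1 * p.2 - p.1 * q.2, ?_⟩
  have hdet := S.2
  rw [Matrix.det_fin_two] at hdet
  have hdet' : (S.1 0 0 * S.1 1 1 - S.1 0 1 * S.1 1 0 : ℂ) = 1 := by exact_mod_cast hdet
  simp only [latticePhase, latticePoint, Prod.fst_sub, Prod.snd_sub]
  push_cast
  linear_combination (Complex.I * Real.pi * (q.1 * p.2 - p.1 * q.2 : ℂ)) * hdet'

/-! ### Cancellation for odd windows -/

theorem inner_tfShift_neg_of_odd {g : L2R} (hodd : ∀ᵐ t : ℝ, g (-t) = -g t) (q : ℝ × ℝ) :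
    (inner ℂ (tfShift (-q) g) gauss : ℂ) = -inner ℂ (tfShift q g) gauss := by
  have h (p : ℝ × ℝ) : (inner ℂ (tfShift p g) gauss : ℂ) =
      ∫ t, gaussFun t * conj (tfShiftFun p g t) := by
    rw [inner_L2R]
    refine integral_congr_ae ?_
    filter_upwards [coeFn_gauss, coeFn_tfShift p g] with t h1 h2
    rw [h1, h2]
  rw [h, h, ← integral_neg_eq_self, ← integral_neg]
  refine integral_congr_ae ?_
  have hodd' := (measurePreserving_sub_right volume q.1).quasiMeasurePreserving.ae hodd
  filter_upwards [hodd'] with t ht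
  have e1 : -t - (-q).1 = -(t - q.1) := by rw [Prod.fst_neg]; ring
  simp only [tfShiftFun, e1, ht, gaussFun]
  rw [mul_neg, map_neg, mul_neg]
  congr 4
  · simp
  · simp

theorem tsum_eq_zero_of_forall_neg {a : ℤ × ℤ → ℂ} (v : ℤ × ℤ) (h : ∀ p, a (v - p) = -a p) :
    ∑' p, a p = 0 := by
  have h1 := (Equiv.subLeft v).tsum_eq a
  simp only [Equiv.subLeft_apply, h, tsum_neg] at h1
  exact CharZero.eq_neg_self_iff.mp h1.symm

theorem tsum_inner_latticeShift_of_odd {g : L2R} (hodd : ∀ᵐ t : ℝ, g (-t) = -g t) (e : ℤ)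
    (M : Matrix (Fin 2) (Fin 2) ℝ) :
    ∑' p, (inner ℂ (latticeShift e M p g) gauss : ℂ) = 0 := by
  refine tsum_eq_zero_of_forall_neg 0 fun p => ?_
  rw [zero_sub, inner_latticeShift_left, inner_latticeShift_left, latticePoint_neg,
    inner_tfShift_neg_of_odd hodd, mul_neg]
  congr 2
  rw [Complex.exp_eq_exp_iff_exists_int]
  -- The quadratic phase is even; the twist is unchanged by `p ↦ -p` because it is a sign.
  refine ⟨e * p.1, ?_⟩
  simp only [latticePhase, latticePoint_neg, Prod.fst_neg, Prod.snd_neg]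
  push_cast
  ring

theorem latticePoint_one (p : ℤ × ℤ) :
    latticePoint (1 : Matrix.SpecialLinearGroup (Fin 2) ℝ).1 p = ((p.1 : ℝ), (p.2 : ℝ)) := by
  simp [latticePoint]

theorem tsum_inner_latticeShift_half_of_odd {g : L2R} (hodd : ∀ᵐ t : ℝ, g (-t) = -g t) (e : ℤ) :
    ∑' p, (inner ℂ (latticeShift e (1 : Matrix.SpecialLinearGroup (Fin 2) ℝ).1 p
      (tfShift (0, 1 / 2) g)) gauss : ℂ) = 0 := by
  -- The map `p ↦ (0, -1) - p` acts on the coset `ℤ² + (0, 1/2)` as negation.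
  refine tsum_eq_zero_of_forall_neg (0, -1) fun p => ?_
  have hneg : latticePoint (1 : Matrix.SpecialLinearGroup (Fin 2) ℝ).1 ((0, -1) - p) + (0, 1 / 2) =
      -(latticePoint (1 : Matrix.SpecialLinearGroup (Fin 2) ℝ).1 p + (0, 1 / 2)) := by
    rw [latticePoint_one, latticePoint_one]
    ext
    · simp
    · simp
      ring
  rw [inner_latticeShift_left, inner_latticeShift_left, tfShift_tfShift, tfShift_tfShift,
    inner_smul_left, inner_smul_left, hneg, inner_tfShift_neg_of_odd hodd, ← Complex.exp_conj,
    ← Complex.exp_conj, mul_neg, mul_neg, ← mul_assoc, ← mul_assoc, ← Complex.exp_add,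
    ← Complex.exp_add]
  congr 2
  rw [Complex.exp_eq_exp_iff_exists_int]
  refine ⟨e * p.1 - p.1, ?_⟩
  simp only [latticePhase, latticePoint_one, Prod.fst_sub, Prod.snd_sub]
  simp [map_ofNat]
  ring

/-! ### Nonvanishing for the Gaussian -/

theorem summable_gauss_latticePoint (S : Matrix.SpecialLinearGroup (Fin 2) ℝ) :
    Summable fun p => Real.exp (-(Real.pi / 2) *
      ((latticePoint S.1 p).1 ^ 2 + (latticePoint S.1 p).2 ^ 2)) := by
  obtain ⟨C, hC⟩ := exists_sum_lattice_gauss_le S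
  refine summable_of_sum_le (c := C) (fun _ => (Real.exp_pos _).le) fun F => ?_
  simpa using hC 0 F

theorem inner_latticeShift_gauss (e : ℤ) (M : Matrix (Fin 2) (Fin 2) ℝ) (p : ℤ × ℤ) :
    (inner ℂ (latticeShift e M p gauss) gauss : ℂ) =
      gaussConst * (Complex.exp (-(Real.pi * Complex.I * (p.1 * p.2 + e * p.1))) *
        (Real.exp (-(Real.pi / 2) * ((latticePoint M p).1 ^ 2 + (latticePoint M p).2 ^ 2)) : ℝ)) := by
  rw [inner_latticeShift_left, inner_tfShift_gauss, ← mul_assoc, ← Complex.exp_add, mul_left_comm]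
  congr 3
  simp only [latticePhase]
  push_cast
  ring

theorem summable_inner_latticeShift_gauss (e : ℤ) (S : Matrix.SpecialLinearGroup (Fin 2) ℝ) :
    Summable fun p => (inner ℂ (latticeShift e S.1 p gauss) gauss : ℂ) := by
  refine Summable.of_norm (((summable_gauss_latticePoint S).mul_left ‖gaussConst‖).congr fun p => ?_)
  rw [inner_latticeShift_gauss, norm_mul, norm_mul, Complex.norm_real,
    Real.norm_of_nonneg (Real.exp_pos _).le,
    norm_exp_mul_I_ofReal (-(Real.pi * (p.1 * p.2 + e * p.1))) (by push_cast; ring), one_mul]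

/-- The Gaussian does not vanish on one of two joint eigenvectors of the lattice shifts. -/
theorem exists_tsum_inner_latticeShift_gauss_ne_zero (S : Matrix.SpecialLinearGroup (Fin 2) ℝ) :
    ∃ e : ℤ, ∑' p, (inner ℂ (latticeShift e S.1 p gauss) gauss : ℂ) ≠ 0 := by
  by_contra! h
  set E : ℤ × ℤ → ℝ := fun p => Real.exp (-(Real.pi / 2) *
    ((latticePoint S.1 p).1 ^ 2 + (latticePoint S.1 p).2 ^ 2)) with hE
  set r : ℤ × ℤ → ℝ := fun p => if Even p.1 then 2 * E p else 0 with hr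
  have hEp (p) : 0 < E p := Real.exp_pos _
  have hr0 (p) : 0 ≤ r p := by
    simp only [hr]
    split_ifs
    · linarith [hEp p]
    · exact le_rfl
  have hsr : Summable r := by
    refine Summable.of_nonneg_of_le hr0 (fun p => ?_) ((summable_gauss_latticePoint S).mul_left 2)
    simp only [hr]
    split_ifs
    · exact le_rfl
    · linarith [hEp p]
  have hpos : 0 < ∑' p, r p := hsr.tsum_pos hr0 0 (by simp [hr, hEp])
  -- Adding the cases `e = 0` and `e = 1` cancels the terms with odd `k`; for even `k` the sign
  -- `(-1)^{kl}` is 1, leaving positive terms times `gaussConst`.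
  have hterm (p : ℤ × ℤ) : (inner ℂ (latticeShift 0 S.1 p gauss) gauss : ℂ) +
      inner ℂ (latticeShift 1 S.1 p gauss) gauss = gaussConst * (r p : ℝ) := by
    rw [inner_latticeShift_gauss, inner_latticeShift_gauss, ← mul_add, ← add_mul]
    congr 1
    simp only [hr]
    obtain ⟨k, l⟩ := p
    rcases Int.even_or_odd k with hk | hk
    · rw [if_pos hk]
      obtain ⟨m, rfl⟩ := hk
      have h1 : Complex.exp (-(Real.pi * Complex.I * ((m + m : ℤ) * l + (0 : ℤ) * (m + m : ℤ)))) = 1 := by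
        rw [Complex.exp_eq_one_iff]
        exact ⟨-(m * l), by push_cast; ring⟩
      have h2 : Complex.exp (-(Real.pi * Complex.I * ((m + m : ℤ) * l + (1 : ℤ) * (m + m : ℤ)))) = 1 := by
        rw [Complex.exp_eq_one_iff]
        exact ⟨-(m * l + m), by push_cast; ring⟩
      rw [h1, h2, Complex.ofReal_mul, one_add_one_eq_two, Complex.ofReal_ofNat]
    · rw [if_neg (Int.not_even_iff_odd.mpr hk)]
      obtain ⟨m, rfl⟩ := hk
      have h1 : Complex.exp (-(Real.pi * Complex.I *
          ((2 * m + 1 : ℤ) * l + (1 : ℤ) * (2 * m + 1 : ℤ)))) =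
          -Complex.exp (-(Real.pi * Complex.I * ((2 * m + 1 : ℤ) * l + (0 : ℤ) * (2 * m + 1 : ℤ)))) := by
        rw [← Complex.exp_add_pi_mul_I, Complex.exp_eq_exp_iff_exists_int]
        exact ⟨-(m + 1), by push_cast; ring⟩
      rw [h1]
      simp
  have hsum := (summable_inner_latticeShift_gauss 0 S).tsum_add
    (summable_inner_latticeShift_gauss 1 S)
  rw [h 0, h 1, add_zero] at hsum
  simp_rw [hterm] at hsum
  rw [tsum_mul_left, ← Complex.ofReal_tsum, mul_eq_zero, Complex.ofReal_eq_zero] at hsum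
  rcases hsum with h1 | h1
  · exact gaussConst_ne_zero h1
  · exact hpos.ne' h1

/-! ### Vanishing of the lower frame bounds -/

theorem tendsto_tsum_enorm_inner_latticeShift (e : ℤ) (S : Matrix.SpecialLinearGroup (Fin 2) ℝ)
    {g : L2R} (hs : Summable fun p => ‖(inner ℂ (tfShift (latticePoint S.1 p) g) gauss : ℂ)‖)
    (h0 : ∑' p, (inner ℂ (latticeShift e S.1 p g) gauss : ℂ) = 0) :
    Tendsto (fun N : ℕ => (∑' q, ‖(inner ℂ (tfShift (latticePoint S.1 q) g)
      (∑ p ∈ intSquare N, latticeShift e S.1 p gauss) : ℂ)‖ₑ ^ 2) /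
      ENNReal.ofReal ((N : ℝ) ^ 2)) atTop (𝓝 0) := by
  have hs' : Summable fun p => (inner ℂ (latticeShift e S.1 p g) gauss : ℂ) := by
    refine Summable.of_norm (hs.congr fun p => ?_)
    rw [norm_inner_latticeShift_left]
  refine (tendsto_tsum_norm_inner_sq_sum_intSquare hs' h0 (φ := fun p => latticeShift e S.1 p gauss)
    (γ := fun p => latticeShift e S.1 p g)
    fun p q => inner_latticeShift_latticeShift e S gauss g p q).congr fun N => ?_
  simp_rw [← ofReal_norm, norm_inner_latticeShift_left]

/-- A Gabor system of an odd window in Feichtinger's algebra over a lattice of density `1` has no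
positive lower frame bound. -/
theorem lowerFrameBound_gaborSystem_of_odd {g : L2R} (hg : MemFeichtinger g)
    (hodd : ∀ᵐ t : ℝ, g (-t) = -g t) (S : Matrix.SpecialLinearGroup (Fin 2) ℝ) :
    lowerFrameBound (gaborSystem g (planeLattice S.1)) = 0 := by
  obtain ⟨e, he⟩ := exists_tsum_inner_latticeShift_gauss_ne_zero S
  have hs : Summable fun p => ‖(inner ℂ (tfShift (latticePoint S.1 p) g) gauss : ℂ)‖ := by
    simpa using summable_norm_inner_gauss hg S 0
  refine sSup_eq_bot.mpr fun A hA => ?_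
  refine eq_zero_of_forall_mul_enorm_sq_le (summable_inner_latticeShift_gauss e S)
    (fun p q => inner_latticeShift_latticeShift e S gauss gauss p q) he
    (tendsto_tsum_enorm_inner_latticeShift e S hs (tsum_inner_latticeShift_of_odd hodd e S.1))
    fun N => (hA _).trans ?_
  let ι : ℤ × ℤ → planeLattice S.1 := fun p => ⟨latticePoint S.1 p, p.1, p.2, rfl⟩
  have hι : Function.Surjective ι := by
    rintro ⟨_, k, l, rfl⟩
    exact ⟨(k, l), rfl⟩
  -- Surjectivity suffices: repeated points could only enlarge the upper bound.
  exact ENNReal.tsum_le_tsum_comp_of_surjective hι _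

theorem not_isFrame_of_lowerFrameBound_eq_zero {ι : Type} {φ : ι → L2R}
    (h : lowerFrameBound φ = 0) : ¬ IsFrame φ := by
  rintro ⟨A, B, hA, -, hAB⟩
  have h1 : ENNReal.ofReal A ≤ lowerFrameBound φ := le_sSup fun f => (hAB f).1
  rw [h] at h1
  exact absurd (ENNReal.ofReal_pos.mpr hA) (not_lt.mpr h1)

theorem lowerFrameBound_gaborSystem_half_of_odd {g : L2R} (hg : MemFeichtinger g)
    (hodd : ∀ᵐ t : ℝ, g (-t) = -g t) :
    lowerFrameBound (gaborSystem g {p : ℝ × ℝ | ∃ k l : ℤ, p = ((k : ℝ), (l : ℝ) / 2)}) = 0 := by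
  obtain ⟨e, he⟩ := exists_tsum_inner_latticeShift_gauss_ne_zero 1
  have hnorm (p : ℤ × ℤ) (f : L2R) : ‖(inner ℂ (tfShift (latticePoint
      (1 : Matrix.SpecialLinearGroup (Fin 2) ℝ).1 p) (tfShift (0, 1 / 2) g)) f : ℂ)‖ =
      ‖(inner ℂ (tfShift (latticePoint (1 : Matrix.SpecialLinearGroup (Fin 2) ℝ).1 p +
        (0, 1 / 2)) g) f : ℂ)‖ := by
    rw [tfShift_tfShift, inner_smul_left, norm_mul, RCLike.norm_conj,
      norm_exp_mul_I_ofReal (-(Real.pi * p.1)) (by rw [latticePoint_one]; push_cast; ring), one_mul]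
  have hs : Summable fun p => ‖(inner ℂ (tfShift (latticePoint
      (1 : Matrix.SpecialLinearGroup (Fin 2) ℝ).1 p) g) gauss : ℂ)‖ := by
    simpa using summable_norm_inner_gauss hg 1 0
  have hs' : Summable fun p => ‖(inner ℂ (tfShift (latticePoint
      (1 : Matrix.SpecialLinearGroup (Fin 2) ℝ).1 p) (tfShift (0, 1 / 2) g)) gauss : ℂ)‖ :=
    (summable_norm_inner_gauss hg 1 (0, 1 / 2)).congr fun p => (hnorm p gauss).symm
  have ht := (tendsto_tsum_enorm_inner_latticeShift e 1 hs
    (tsum_inner_latticeShift_of_odd hodd e _)).add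
    (tendsto_tsum_enorm_inner_latticeShift e 1 hs' (tsum_inner_latticeShift_half_of_odd hodd e))
  simp_rw [← ENNReal.add_div, add_zero] at ht
  refine sSup_eq_bot.mpr fun A hA => ?_
  refine eq_zero_of_forall_mul_enorm_sq_le (summable_inner_latticeShift_gauss e 1)
    (fun p q => inner_latticeShift_latticeShift e 1 gauss gauss p q) he ht fun N => (hA _).trans ?_
  -- Even `l` gives `ℤ²`, odd `l` gives its coset by `(0, 1/2)`.
  let ι : (ℤ × ℤ) ⊕ (ℤ × ℤ) → {p : ℝ × ℝ | ∃ k l : ℤ, p = ((k : ℝ), (l : ℝ) / 2)} :=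
    Sum.elim (fun p => ⟨((p.1 : ℝ), (p.2 : ℝ)), p.1, 2 * p.2, by push_cast; ext <;> simp⟩)
      (fun p => ⟨((p.1 : ℝ), (p.2 : ℝ) + 1 / 2), p.1, 2 * p.2 + 1, by
        push_cast; ext <;> simp; ring⟩)
  have hι : Function.Surjective ι := by
    rintro ⟨_, k, l, rfl⟩
    rcases Int.even_or_odd' l with ⟨m, rfl | rfl⟩
    · refine ⟨Sum.inl (k, m), Subtype.ext ?_⟩
      simp [ι]
    · refine ⟨Sum.inr (k, m), Subtype.ext ?_⟩
      simp [ι]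
      ring
  refine (ENNReal.tsum_le_tsum_comp_of_surjective hι _).trans (le_of_eq ?_)
  rw [Summable.tsum_sum ENNReal.summable ENNReal.summable]
  congr 1
  · refine tsum_congr fun p => ?_
    rw [latticePoint_one]
    rfl
  · refine tsum_congr fun p => ?_
    rw [← ofReal_norm, ← ofReal_norm, hnorm, latticePoint_one]
    simp [ι, gaborSystem]

theorem proposition5p3 (g : L2R) (hg : MemFeichtinger g)
    (hodd : ∀ᵐ t : ℝ, g (-t) = -g t) :
    (∀ S : Matrix.SpecialLinearGroup (Fin 2) ℝ,
      lowerFrameBound (gaborSystem g (planeLattice S.1)) = 0 ∧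
        ¬ IsFrame (gaborSystem g (planeLattice S.1))) ∧
      ¬ IsFrame (gaborSystem g {p : ℝ × ℝ | ∃ k l : ℤ, p = ((k : ℝ), (l : ℝ) / 2)}) :=
  ⟨fun S => ⟨lowerFrameBound_gaborSystem_of_odd hg hodd S,
    not_isFrame_of_lowerFrameBound_eq_zero (lowerFrameBound_gaborSystem_of_odd hg hodd S)⟩,
    not_isFrame_of_lowerFrameBound_eq_zero (lowerFrameBound_gaborSystem_half_of_odd hg hodd)⟩
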